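/- Let $n\ge 3$ be an integer, let $\mathbb{R}^n_+=\{x=(x',x_n)\in\mathbb{R}^{n-1}\times\mathbb{R}: x_n>0\}$, and identify $\partial\mathbb{R}^n_+$ with $\mathbb{R}^{n-1}$; both carry Lebesgue measure, and $|\cdot|$ is the Euclidean norm. For $x=(x',x_n)\in\mathbb{R}^n_+$ and $\xi\in\partial\mathbb{R}^n_+$ let $$P(x,\xi,2)=\frac{x_n}{(|x'-\xi|^2+x_n^2)^{n/2}}$$ be the (unnormalized) classical Poisson kernel. Let $1<p<\infty$ and $1<q'<\infty$, and let $p'$ and $q$ be the conjugate exponents, $\frac1p+\frac1{p'}=1$ and $\frac1q+\frac1{q'}=1$. Let $\alpha,\beta\in\mathbb{R}$ satisfy $\alpha<\frac{n-1}{p'}$, $\beta<\frac nq+1$ and $\alpha+\beta=0$, and suppose that $$\frac{n-1}{n}\,\frac1p+\frac1{q'}=1 .$$ Then there is a constant $C>0$, depending only on $n,\alpha,\beta,p,q'$, such that for all real-valued $f\in L^p(\partial\mathbb{R}^n_+)$ and $g\in L^{q'}(\mathbb{R}^n_+)$ the function $(x,\xi)\mapsto|\xi|^{-\alpha}f(\xi)P(x,\xi,2)g(x)|x|^{-\beta}$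 is integrable on $\mathbb{R}^n_+\times\partial\mathbb{R}^n_+$ and $$\int_{\mathbb{R}^n_+}\int_{\partial\mathbb{R}^n_+}|\xi|^{-\alpha}f(\xi)\,P(x,\xi,2)\,g(x)\,|x|^{-\beta}\,d\xi\,dx\le C\,\|g\|_{L^{q'}(\mathbb{R}^n_+)}\,\|f\|_{L^p(\partial\mathbb{R}^n_+)} .$$ -/

import Mathlib

open MeasureTheory

namespace SteinWeiss

noncomputable section

/-- The boundary `∂ℝⁿ₊`, identified with `ℝⁿ⁻¹` (Euclidean norm, Lebesgue measure `volume`). -/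
abbrev Boundary (n : ℕ) : Type := EuclideanSpace ℝ (Fin (n - 1))

/-- Points of `ℝⁿ = ℝⁿ⁻¹ × ℝ`, written `x = (x', xₙ)` with `x' = x.1` and `xₙ = x.2`.
Its measure `volume` is the product Lebesgue measure. The norm that Mathlib puts on a product is
the sup norm, which is not used: see `euclNorm`. -/
abbrev Point (n : ℕ) : Type := Boundary n × ℝ

/-- The open upper half space `ℝⁿ₊ = {(x', xₙ) : xₙ > 0}`. -/
def upperHalfSpace (n : ℕ) : Set (Point n) := {x | 0 < x.2}

/-- The Lebesgue measure of the upper half space. -/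
def halfSpaceMeasure (n : ℕ) : Measure (Point n) := volume.restrict (upperHalfSpace n)

/-- The Euclidean norm `|x| = (|x'|² + xₙ²)^{1/2}` on `ℝⁿ = ℝⁿ⁻¹ × ℝ`. -/
def euclNorm {n : ℕ} (x : Point n) : ℝ := Real.sqrt (‖x.1‖ ^ 2 + x.2 ^ 2)

/-- The fractional Poisson kernel `P(x, ξ, γ) = xₙ / (|x' - ξ|² + xₙ²)^{(n + 2 - γ)/2}`; for
`γ = 2` it is the classical Poisson kernel (up to a normalizing constant). -/
def poissonKernel {n : ℕ} (x : Point n) (ξ : Boundary n) (γ : ℝ) : ℝ :=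
  x.2 / (‖x.1 - ξ‖ ^ 2 + x.2 ^ 2) ^ (((n : ℝ) + 2 - γ) / 2)

end

end SteinWeiss

/-! Since β = -α, the kernel is |ξ|^(-α) P |x|^α, homogeneous of degree -(n-1). Where |ξ| and |x|
are comparable, the weights cancel up to the factor 2^|α| and P remains. Elsewhere the distance from
x to ξ is at least half of max(|x|, |ξ|), and the kernel is at most a constant times |ξ|^(-c)
|x|^(-d) for any c + d = n - 1 with d ≥ 0, α ≤ c and -α ≤ 1 + d
(`exists_weighted_poissonKernel_le`). For c = (n-1)(1-ρ), d = (n-1)ρ and ρ = 1/p, the last two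
conditions are the hypotheses on α and β, which are strict.

Over sets E and F both pieces integrate to at most C |F|^ρ |E|^(1-(n-1)ρ/n). For the product of
powers this is a rearrangement bound in each factor. For P it is the geometric mean of the bounds
C|E| (bounded mass of P) and C|E|^(1/n)|F| (P is at most the distance to the power -(n-1)).

Strictness leaves room to take ρ = 1/p ± δ. Cutting f and g into levels and using the better of the
two estimates for each pair (k, l) of levels gives decay 2^(-|k-l|). The double sum then converges
because 1/p + 1/q' = 1 + 1/(np) ≥ 1 (`exists_lintegral_lintegral_le_of_restricted_type`). -/

namespace SteinWeiss

/-! ### Negative powers of the distance over sets of given measure -/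

/-- The negative power `t ^ (-1/θ)` capped by `m` at small `t` has integral at most
`m ^ (1 - θ)` up to a constant. -/
lemma lintegral_Ioi_le_of_le_of_le_rpow {θ m B : ℝ} (hθ : 0 < θ) (hθ1 : θ < 1) (hm : 0 < m)
    (hB : 0 ≤ B) {h : ℝ → ENNReal} (h1 : ∀ t, 0 < t → h t ≤ ENNReal.ofReal m)
    (h2 : ∀ t, 0 < t → h t ≤ ENNReal.ofReal (B * t ^ (-(1 / θ)))) :
    ∫⁻ t in Set.Ioi 0, h t ≤ ENNReal.ofReal ((1 + B * (θ / (1 - θ))) * m ^ (1 - θ)) := by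
  -- The point where `t ^ (-(1 / θ))` equals `m`: the cap is used to its left, the power to its
  -- right, where it is integrable because `θ < 1`.
  set T : ℝ := m ^ (-θ) with hT
  have hTpos : 0 < T := Real.rpow_pos_of_pos hm _
  have hsub : Set.Ioi (0 : ℝ) ⊆ Set.Ioc 0 T ∪ Set.Ioi T := by
    intro t ht
    rcases le_or_gt t T with h | h
    · exact Or.inl ⟨ht, h⟩
    · exact Or.inr h
  have hlt : -(1 / θ) < -1 := by
    have := (one_lt_div hθ).2 hθ1
    linarith
  have hfirst : ∫⁻ t in Set.Ioc 0 T, h t ≤ ENNReal.ofReal (m ^ (1 - θ)) := by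
    calc ∫⁻ t in Set.Ioc 0 T, h t ≤ ∫⁻ _ in Set.Ioc 0 T, ENNReal.ofReal m :=
          setLIntegral_mono measurable_const fun t ht => h1 t ht.1
      _ = ENNReal.ofReal (m ^ (1 - θ)) := by
          rw [setLIntegral_const, Real.volume_Ioc, ← ENNReal.ofReal_mul hm.le, sub_zero, hT,
            sub_eq_add_neg, Real.rpow_add hm, Real.rpow_one]
  have hsecond : ∫⁻ t in Set.Ioi T, h t ≤
      ENNReal.ofReal (B * (θ / (1 - θ)) * m ^ (1 - θ)) := by
    calc ∫⁻ t in Set.Ioi T, h t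
        ≤ ∫⁻ t in Set.Ioi T, ENNReal.ofReal (B * t ^ (-(1 / θ))) :=
          setLIntegral_mono (by fun_prop) fun t ht => h2 t (hTpos.trans ht)
      _ = ENNReal.ofReal (∫ t in Set.Ioi T, B * t ^ (-(1 / θ))) := by
          rw [ofReal_integral_eq_lintegral_ofReal]
          · exact (integrableOn_Ioi_rpow_of_lt hlt hTpos).const_mul B
          · refine (ae_restrict_mem measurableSet_Ioi).mono fun t ht => ?_
            exact mul_nonneg hB (Real.rpow_nonneg (hTpos.trans ht).le _)
      _ = ENNReal.ofReal (B * (θ / (1 - θ)) * m ^ (1 - θ)) := by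
          rw [integral_const_mul, integral_Ioi_rpow_of_lt hlt hTpos, hT, ← Real.rpow_mul hm.le]
          have e1 : -θ * (-(1 / θ) + 1) = 1 - θ := by field_simp; ring
          have e2 : -(1 / θ) + 1 = -((1 - θ) / θ) := by field_simp; ring
          rw [e1, e2]
          have : 1 - θ ≠ 0 := by linarith
          congr 1
          field_simp
  calc ∫⁻ t in Set.Ioi 0, h t ≤ ∫⁻ t in Set.Ioc 0 T ∪ Set.Ioi T, h t := lintegral_mono_set hsub
    _ ≤ (∫⁻ t in Set.Ioc 0 T, h t) + ∫⁻ t in Set.Ioi T, h t := lintegral_union_le _ _ _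
    _ ≤ ENNReal.ofReal (m ^ (1 - θ)) + ENNReal.ofReal (B * (θ / (1 - θ)) * m ^ (1 - θ)) :=
        add_le_add hfirst hsecond
    _ = ENNReal.ofReal ((1 + B * (θ / (1 - θ))) * m ^ (1 - θ)) := by
        have : 0 < 1 - θ := by linarith
        rw [← ENNReal.ofReal_add (by positivity) (by positivity)]
        ring_nf

/-- Among all sets of given measure, the integral of a negative power of the distance to a point is
controlled by the corresponding power of the measure. -/
lemma exists_setLIntegral_norm_sub_rpow_le {V : Type*} [NormedAddCommGroup V] [NormedSpace ℝ V]
    [FiniteDimensional ℝ V] [Nontrivial V] [MeasurableSpace V] [BorelSpace V] (μ : Measure V)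
    [μ.IsAddHaarMeasure] {θ : ℝ} (hθ : 0 < θ) (hθ1 : θ < 1) :
    ∃ C : ENNReal, C ≠ ⊤ ∧ ∀ (a : V) (E : Set V),
      ∫⁻ x in E, ENNReal.ofReal (‖x - a‖ ^ (-(θ * Module.finrank ℝ V))) ∂μ
        ≤ C * μ E ^ (1 - θ) := by
  set d : ℝ := (Module.finrank ℝ V : ℝ) with hd
  have hdpos : 0 < d := by rw [hd]; exact_mod_cast Module.finrank_pos
  set B : ℝ := (μ (Metric.ball (0 : V) 1)).toReal with hB
  have hBtop : μ (Metric.ball (0 : V) 1) ≠ ⊤ := measure_ball_lt_top.ne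
  have hθ' : 0 < 1 - θ := by linarith
  have hCpos : 0 < 1 + B * (θ / (1 - θ)) := by positivity
  refine ⟨ENNReal.ofReal (1 + B * (θ / (1 - θ))), ENNReal.ofReal_ne_top, fun a E => ?_⟩
  rcases eq_or_ne (μ E) ⊤ with hE | hE
  · rw [hE, ENNReal.top_rpow_of_pos hθ', ENNReal.mul_top]
    · exact le_top
    · simpa using hCpos
  rcases eq_or_ne (μ E) 0 with hE0 | hE0
  · rw [Measure.restrict_eq_zero.2 hE0]
    simp
  have hm : 0 < (μ E).toReal := ENNReal.toReal_pos hE0 hE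
  have hmeas : Measurable fun x : V => ‖x - a‖ ^ (-(θ * d)) := by fun_prop
  -- Layer cake: a superlevel set within `E` has measure at most `μ E`, and lies in a ball of
  -- measure `B * t ^ (-(1 / θ))`.
  rw [lintegral_eq_lintegral_meas_lt _ (Filter.Eventually.of_forall fun x =>
    Real.rpow_nonneg (norm_nonneg _) _) hmeas.aemeasurable]
  refine (lintegral_Ioi_le_of_le_of_le_rpow hθ hθ1 hm ENNReal.toReal_nonneg (B := B)
    (fun t _ => ?_) fun t ht => ?_).trans_eq ?_
  · rw [ENNReal.ofReal_toReal hE]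
    exact (measure_mono (Set.subset_univ _)).trans_eq (by simp)
  · refine (Measure.restrict_apply_le _ _).trans ?_
    have hsub : {x : V | t < ‖x - a‖ ^ (-(θ * d))} ⊆ Metric.ball a (t ^ (-(1 / (θ * d)))) := by
      intro x hx
      rw [Set.mem_ofPred_eq] at hx
      rw [mem_ball_iff_norm]
      rcases eq_or_ne (x - a) 0 with h0 | h0
      · rw [h0, norm_zero]; exact Real.rpow_pos_of_pos ht _
      have hn : 0 < ‖x - a‖ := norm_pos_iff.2 h0
      have := Real.rpow_lt_rpow_of_neg ht hx
        (z := -(1 / (θ * d))) (by have := mul_pos hθ hdpos; simp only [neg_lt_zero]; positivity)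
      rwa [← Real.rpow_mul hn.le, show -(θ * d) * -(1 / (θ * d)) = 1 by field_simp,
        Real.rpow_one] at this
    refine (measure_mono hsub).trans ?_
    rw [Measure.addHaar_ball μ a (Real.rpow_nonneg ht.le _), mul_comm, ENNReal.ofReal_mul
      ENNReal.toReal_nonneg, ENNReal.ofReal_toReal hBtop, ← Real.rpow_natCast, ← Real.rpow_mul ht.le,
      ← hd, show -(1 / (θ * d)) * d = -(1 / θ) by field_simp]
  · rw [ENNReal.ofReal_mul hCpos.le, ← ENNReal.ofReal_rpow_of_pos hm, ENNReal.ofReal_toReal hE]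

/-! ### Mass and pointwise bounds of the Poisson kernel -/

/-- The mass of the Poisson kernel is bounded uniformly in the half space. -/
lemma exists_lintegral_poissonKernel_le (n : ℕ) (hn : 1 ≤ n) :
    ∃ C : ENNReal, C ≠ ⊤ ∧ ∀ x : Point n, 0 < x.2 →
      ∫⁻ ξ, ENNReal.ofReal (poissonKernel x ξ 2) ≤ C := by
  have hfr : Module.finrank ℝ (Boundary n) = n - 1 := by simp
  have hint : Integrable (fun η : Boundary n => (1 + ‖η‖ ^ 2) ^ (-(n : ℝ) / 2)) := by
    apply integrable_rpow_neg_one_add_norm_sq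
    rw [hfr]
    exact_mod_cast Nat.sub_lt hn one_pos
  refine ⟨∫⁻ η : Boundary n, ENNReal.ofReal ((1 + ‖η‖ ^ 2) ^ (-(n : ℝ) / 2)),
    hint.lintegral_lt_top.ne, fun x hx => ?_⟩
  set t := x.2
  -- Rescaling by the height `t` produces the factor `t ^ (1 - n)`, which the Jacobian `t ^ (n - 1)`
  -- of the substitution cancels.
  have key : ∀ ξ : Boundary n, ENNReal.ofReal (poissonKernel x ξ 2) =
      ENNReal.ofReal (t ^ (1 - n : ℝ)) *
        ENNReal.ofReal ((1 + ‖t⁻¹ • (x.1 - ξ)‖ ^ 2) ^ (-(n : ℝ) / 2)) := by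
    intro ξ
    rw [← ENNReal.ofReal_mul (by positivity), poissonKernel]
    congr 1
    have e : ‖x.1 - ξ‖ ^ 2 + x.2 ^ 2 = t ^ 2 * (1 + ‖t⁻¹ • (x.1 - ξ)‖ ^ 2) := by
      rw [norm_smul, norm_inv, Real.norm_of_nonneg hx.le, mul_pow, inv_pow]
      field_simp
      ring
    rw [e, Real.mul_rpow (by positivity) (by positivity), ← Real.rpow_natCast t 2,
      ← Real.rpow_mul hx.le, add_sub_cancel_right, neg_div, Real.rpow_neg (by positivity),
      Real.rpow_sub hx, Real.rpow_one]
    rw [show ((2 : ℕ) : ℝ) * ((n : ℝ) / 2) = n by push_cast; ring]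
    rw [div_mul_eq_div_div, div_eq_mul_inv]
  simp_rw [key]
  rw [lintegral_const_mul _ (by fun_prop)]
  rw [lintegral_sub_left_eq_self (fun ζ : Boundary n =>
    ENNReal.ofReal ((1 + ‖t⁻¹ • ζ‖ ^ 2) ^ (-(n : ℝ) / 2))) x.1]
  have hmap := Measure.map_addHaar_smul (volume : Measure (Boundary n)) (inv_ne_zero hx.ne')
  have : ∫⁻ ζ : Boundary n, ENNReal.ofReal ((1 + ‖t⁻¹ • ζ‖ ^ 2) ^ (-(n : ℝ) / 2)) =
      ENNReal.ofReal |((t⁻¹) ^ Module.finrank ℝ (Boundary n))⁻¹| *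
        ∫⁻ η : Boundary n, ENNReal.ofReal ((1 + ‖η‖ ^ 2) ^ (-(n : ℝ) / 2)) := by
    rw [← smul_eq_mul, ← lintegral_smul_measure, ← hmap, lintegral_map (by fun_prop) (by fun_prop)]
  rw [this, ← mul_assoc, ← ENNReal.ofReal_mul (by positivity), hfr, abs_of_nonneg (by positivity),
    inv_pow, inv_inv, ← Real.rpow_natCast t (n - 1), ← Real.rpow_add hx, Nat.cast_sub hn]
  simp

lemma euclNorm_pos {n : ℕ} {x : Point n} (hx : 0 < x.2) : 0 < euclNorm x :=
  Real.sqrt_pos.2 (by positivity)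

/-- One direction suffices for passing to the sup norm, since the powers in which it replaces the
Euclidean norm are nonpositive. -/
lemma norm_le_euclNorm {n : ℕ} (x : Point n) : ‖x‖ ≤ euclNorm x := by
  refine max_le (Real.le_sqrt_of_sq_le ?_) (Real.le_sqrt_of_sq_le ?_)
  · nlinarith [sq_nonneg x.2]
  · rw [Real.norm_eq_abs, sq_abs]
    nlinarith [sq_nonneg ‖x.1‖]

lemma snd_le_norm {n : ℕ} (x : Point n) : x.2 ≤ ‖x‖ := (le_abs_self _).trans (norm_snd_le x)

lemma snd_le_euclNorm {n : ℕ} (x : Point n) : x.2 ≤ euclNorm x :=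
  (snd_le_norm x).trans (norm_le_euclNorm x)

lemma euclNorm_le_add {n : ℕ} (x y : Point n) : euclNorm (x + y) ≤ euclNorm x + euclNorm y := by
  have key : ∀ z : Point n, euclNorm z = ‖WithLp.toLp 2 z‖ := fun z => by
    rw [WithLp.prod_norm_eq_of_L2, euclNorm]
    simp
  rw [key, key, key, WithLp.toLp_add]
  exact norm_add_le _ _

lemma euclNorm_boundary {n : ℕ} (ξ : Boundary n) : euclNorm ((ξ, 0) : Point n) = ‖ξ‖ := by
  simp [euclNorm]

lemma euclNorm_neg {n : ℕ} (x : Point n) : euclNorm (-x) = euclNorm x := by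
  simp [euclNorm]

/-- The classical Poisson kernel in terms of the distance between its arguments. -/
lemma poissonKernel_two {n : ℕ} (x : Point n) (ξ : Boundary n) :
    poissonKernel x ξ 2 = x.2 / euclNorm (x - (ξ, 0)) ^ (n : ℝ) := by
  rw [poissonKernel, euclNorm, Real.sqrt_eq_rpow, ← Real.rpow_mul (by positivity)]
  simp only [Prod.fst_sub, Prod.snd_sub, sub_zero]
  ring_nf

lemma poissonKernel_nonneg {n : ℕ} {x : Point n} (hx : 0 < x.2) (ξ : Boundary n) (γ : ℝ) :
    0 ≤ poissonKernel x ξ γ := by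
  unfold poissonKernel
  positivity

/-- The Poisson kernel is at most `xₙ r⁻ⁿ` if its arguments have distance at least `r`. -/
lemma poissonKernel_le_of_le {n : ℕ} {x : Point n} (hx : 0 < x.2) {ξ : Boundary n} {r : ℝ}
    (hr : 0 < r) (h : r ≤ euclNorm (x - (ξ, 0))) :
    poissonKernel x ξ 2 ≤ x.2 * r ^ (-(n : ℝ)) := by
  rw [poissonKernel_two, div_eq_mul_inv, Real.rpow_neg hr.le]
  gcongr

/-- The height is at most the distance to any boundary point, so it absorbs one power. The sup norm
is used because the rearrangement bound is applied in the normed space `Point n`. -/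
lemma poissonKernel_le_norm_sub_rpow {n : ℕ} {x : Point n} (hx : 0 < x.2)
    (ξ : Boundary n) :
    poissonKernel x ξ 2 ≤ ‖x - (ξ, 0)‖ ^ (-((n : ℝ) - 1)) := by
  have hx' : 0 < (x - (ξ, 0)).2 := by simpa using hx
  have hne : 0 < ‖x - (ξ, 0)‖ := hx'.trans_le (snd_le_norm _)
  refine (poissonKernel_le_of_le hx hne (norm_le_euclNorm _)).trans ?_
  have : x.2 ≤ ‖x - (ξ, 0)‖ := by
    simpa using snd_le_norm (x - ((ξ, 0) : Point n))
  calc x.2 * ‖x - (ξ, 0)‖ ^ (-(n : ℝ)) ≤ ‖x - (ξ, 0)‖ * ‖x - (ξ, 0)‖ ^ (-(n : ℝ)) := by gcongr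
    _ = ‖x - (ξ, 0)‖ ^ (1 + -(n : ℝ)) := by rw [Real.rpow_add hne, Real.rpow_one]
    _ = _ := by ring_nf

/-- The weighted kernel is controlled by the Poisson kernel near `|ξ| = |x|` and by a product of
powers away from it. -/
lemma exists_weighted_poissonKernel_le (n : ℕ) {α c d : ℝ} (hcd : c + d = n - 1) (hd : 0 ≤ d)
    (h1 : α ≤ c) (h2 : -α ≤ 1 + d) :
    ∃ C : ℝ, 0 ≤ C ∧ ∀ (x : Point n) (ξ : Boundary n), 0 < x.2 → ξ ≠ 0 →
      ‖ξ‖ ^ (-α) * poissonKernel x ξ 2 * euclNorm x ^ α ≤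
        C * (‖ξ‖ ^ (-c) * ‖x‖ ^ (-d) + poissonKernel x ξ 2) := by
  refine ⟨2 ^ (n : ℝ) + 2 ^ |α|, by positivity, fun x ξ hx hξ => ?_⟩
  have hP := poissonKernel_nonneg hx ξ 2
  have hR : 0 < euclNorm x := euclNorm_pos hx
  have hs : 0 < ‖ξ‖ := norm_pos_iff.2 hξ
  have hxn : 0 < ‖x‖ := hx.trans_le (snd_le_norm x)
  have hRd : euclNorm x ^ (-d) ≤ ‖x‖ ^ (-d) :=
    Real.rpow_le_rpow_of_nonpos hxn (norm_le_euclNorm x) (by linarith)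
  have tri1 : euclNorm x ≤ euclNorm (x - (ξ, 0)) + ‖ξ‖ := by
    have := euclNorm_le_add (x - (ξ, 0)) (ξ, 0)
    rwa [sub_add_cancel, euclNorm_boundary] at this
  have tri2 : ‖ξ‖ ≤ euclNorm (x - (ξ, 0)) + euclNorm x := by
    have := euclNorm_le_add (-(x - (ξ, 0))) x
    rwa [neg_sub, sub_add_cancel, euclNorm_boundary, ← neg_sub, euclNorm_neg] at this
  set R := euclNorm x
  set s := ‖ξ‖
  -- The common end of both far regions: `d ≥ 0` allows the smaller sup norm to replace `R`.
  have far : s ^ (-α) * poissonKernel x ξ 2 * R ^ α ≤ 2 ^ (n : ℝ) * (s ^ (-c) * R ^ (-d)) →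
      s ^ (-α) * poissonKernel x ξ 2 * R ^ α ≤
        (2 ^ (n : ℝ) + 2 ^ |α|) * (s ^ (-c) * ‖x‖ ^ (-d) + poissonKernel x ξ 2) := by
    intro h
    calc _ ≤ 2 ^ (n : ℝ) * (s ^ (-c) * R ^ (-d)) := h
      _ ≤ 2 ^ (n : ℝ) * (s ^ (-c) * ‖x‖ ^ (-d)) := by gcongr
      _ ≤ _ := by
        refine mul_le_mul ?_ ?_ (by positivity) (by positivity)
        · have : (0 : ℝ) ≤ 2 ^ |α| := by positivity
          linarith
        · linarith
  rcases le_total s (R / 2) with hsR | hsR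
  · apply far
    have hD : R / 2 ≤ euclNorm (x - (ξ, 0)) := by linarith
    calc s ^ (-α) * poissonKernel x ξ 2 * R ^ α
        ≤ s ^ (-α) * (R * (R / 2) ^ (-(n : ℝ))) * R ^ α := by
          gcongr
          refine (poissonKernel_le_of_le hx (by positivity) hD).trans ?_
          gcongr
          exact snd_le_euclNorm x
      -- The surplus factor is at most `1` because `s ≤ R` and `α ≤ c`.
      _ = 2 ^ (n : ℝ) * (s ^ (-c) * R ^ (-d)) * (s / R) ^ (c - α) := by
          rw [Real.div_rpow hR.le (by norm_num), Real.div_rpow hs.le hR.le,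
            Real.rpow_neg (by norm_num : (0 : ℝ) ≤ 2)]
          have e1 : s ^ (-α) = s ^ (-c) * s ^ (c - α) := by
            rw [← Real.rpow_add hs]; ring_nf
          have e2 : R * R ^ (-(n : ℝ)) * R ^ α * R ^ (c - α) = R ^ (-d) := by
            nth_rewrite 1 [← Real.rpow_one R]
            rw [← Real.rpow_add hR, ← Real.rpow_add hR, ← Real.rpow_add hR]
            congr 1
            linarith
          rw [← e2, e1]
          have : R ^ (c - α) ≠ 0 := by positivity
          field_simp
      _ ≤ 2 ^ (n : ℝ) * (s ^ (-c) * R ^ (-d)) * 1 := by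
          gcongr
          refine Real.rpow_le_one (by positivity) ?_ (by linarith)
          rw [div_le_one hR]
          linarith
      _ = _ := mul_one _
  rcases le_total (2 * R) s with hsR2 | hsR2
  · apply far
    have hD : s / 2 ≤ euclNorm (x - (ξ, 0)) := by linarith
    calc s ^ (-α) * poissonKernel x ξ 2 * R ^ α
        ≤ s ^ (-α) * (R * (s / 2) ^ (-(n : ℝ))) * R ^ α := by
          gcongr
          refine (poissonKernel_le_of_le hx (by positivity) hD).trans ?_
          gcongr
          exact snd_le_euclNorm x
      -- The `1` in the exponent comes from the numerator `x.2 ≤ R` of the kernel; it is what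
      -- weakens the condition on `-α` to `-α ≤ 1 + d`.
      _ = 2 ^ (n : ℝ) * (s ^ (-c) * R ^ (-d)) * (R / s) ^ (1 + α + d) := by
          rw [Real.div_rpow hs.le (by norm_num), Real.div_rpow hR.le hs.le,
            Real.rpow_neg (by norm_num : (0 : ℝ) ≤ 2)]
          have e1 : s ^ (-α) * s ^ (-(n : ℝ)) * s ^ (1 + α + d) = s ^ (-c) := by
            rw [← Real.rpow_add hs, ← Real.rpow_add hs]
            congr 1
            linarith
          have e2 : R ^ (-d) * R ^ (1 + α + d) = R * R ^ α := by
            nth_rewrite 3 [← Real.rpow_one R]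
            rw [← Real.rpow_add hR, ← Real.rpow_add hR]
            ring_nf
          have e3 : s ^ (1 + α + d) ≠ 0 := by positivity
          rw [← e1]
          field_simp
          linear_combination (-1 : ℝ) * e2
      _ ≤ 2 ^ (n : ℝ) * (s ^ (-c) * R ^ (-d)) * 1 := by
          gcongr
          refine Real.rpow_le_one (by positivity) ?_ (by linarith)
          rw [div_le_one hs]
          linarith
      _ = _ := mul_one _
  -- Here `R / s` lies between `1 / 2` and `2`.
  · have hratio : s ^ (-α) * R ^ α ≤ 2 ^ |α| := by
      rw [Real.rpow_neg hs.le, inv_mul_eq_div, ← Real.div_rpow hR.le hs.le]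
      rcases le_total 0 α with hα | hα
      · rw [abs_of_nonneg hα]
        refine Real.rpow_le_rpow (by positivity) ?_ hα
        rw [div_le_iff₀ hs]
        linarith
      · rw [abs_of_nonpos hα, ← neg_neg α, Real.rpow_neg (by positivity), ← Real.inv_rpow
          (by positivity), neg_neg, inv_div]
        refine Real.rpow_le_rpow (by positivity) ?_ (by linarith)
        rwa [div_le_iff₀ hR]
    calc s ^ (-α) * poissonKernel x ξ 2 * R ^ α = (s ^ (-α) * R ^ α) * poissonKernel x ξ 2 := by
          ring
      _ ≤ (2 ^ (n : ℝ) + 2 ^ |α|) * (s ^ (-c) * ‖x‖ ^ (-d) + poissonKernel x ξ 2) := by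
          refine mul_le_mul ?_ ?_ hP (by positivity)
          · have : (0 : ℝ) ≤ 2 ^ (n : ℝ) := by positivity
            linarith
          · have : 0 ≤ s ^ (-c) * ‖x‖ ^ (-d) := by positivity
            linarith

/-! ### Off-diagonal bilinear interpolation -/

/-- `∑ k : ℤ, 2 ^ (-|k|)` is finite. -/
lemma tsum_two_rpow_neg_abs_ne_top :
    ∑' k : ℤ, ENNReal.ofReal ((2 : ℝ) ^ (-|(k : ℝ)|)) ≠ ⊤ := by
  have h : Summable fun k : ℤ => (2 : ℝ) ^ (-|(k : ℝ)|) := by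
    have hg : Summable fun k : ℕ => (2 : ℝ) ^ (-(k : ℝ)) := by
      have := summable_geometric_of_lt_one (r := (2 : ℝ)⁻¹) (by norm_num) (by norm_num)
      refine this.congr fun k => ?_
      rw [Real.rpow_neg (by norm_num), Real.rpow_natCast, inv_pow]
    refine Summable.of_nat_of_neg ?_ ?_
    · simpa using hg
    · simpa using hg
  rw [← ENNReal.ofReal_tsum_of_nonneg (fun k => by positivity) h]
  exact ENNReal.ofReal_ne_top

/-- A function is dominated by its discretization along the powers of `lam`. -/
lemma ofReal_le_tsum_indicator {Y : Type*} {lam : ℝ} (hlam : 1 < lam) (f : Y → ℝ) (y : Y) :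
    ENNReal.ofReal (f y) ≤ ∑' k : ℤ, (f ⁻¹' Set.Ico (lam ^ k) (lam ^ (k + 1))).indicator
      (fun _ => ENNReal.ofReal (lam ^ (k + 1))) y := by
  rcases le_or_gt (f y) 0 with h | h
  · simp [ENNReal.ofReal_of_nonpos h]
  obtain ⟨k, hk⟩ := exists_mem_Ico_zpow h hlam
  refine le_trans ?_ (ENNReal.le_tsum k)
  rw [Set.indicator_of_mem (by exact hk)]
  exact ENNReal.ofReal_le_ofReal hk.2.le

/-- The levels of a function along the powers of `lam` measure its `p`-th moment from below. -/
lemma tsum_measure_level_le {Y : Type*} [MeasurableSpace Y] {ν : Measure Y} {lam p : ℝ}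
    (hlam : 1 < lam) (hp : 0 < p) {f : Y → ℝ} (hf : Measurable f) :
    ∑' k : ℤ, ENNReal.ofReal ((lam ^ k) ^ p) * ν (f ⁻¹' Set.Ico (lam ^ k) (lam ^ (k + 1)))
      ≤ ∫⁻ y, ENNReal.ofReal (f y) ^ p ∂ν := by
  have hdisj : Pairwise (Function.onFun Disjoint
      fun k : ℤ => f ⁻¹' Set.Ico (lam ^ k) (lam ^ (k + 1))) := by
    intro i j hij
    refine Disjoint.preimage _ ?_
    have hmono : Monotone fun k : ℤ => lam ^ k := zpow_right_mono₀ hlam.le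
    simpa using! hmono.pairwise_disjoint_on_Ico_succ hij
  have hms : ∀ k : ℤ, MeasurableSet (f ⁻¹' Set.Ico (lam ^ k) (lam ^ (k + 1))) :=
    fun k => hf measurableSet_Ico
  calc _ ≤ ∑' k : ℤ, ∫⁻ y in f ⁻¹' Set.Ico (lam ^ k) (lam ^ (k + 1)), ENNReal.ofReal (f y) ^ p ∂ν := by
        refine ENNReal.tsum_le_tsum fun k => ?_
        rw [← setLIntegral_const]
        refine setLIntegral_mono (by fun_prop) fun y hy => ?_
        rw [← ENNReal.ofReal_rpow_of_nonneg (by positivity) hp.le]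
        gcongr
        exact hy.1
    _ = ∫⁻ y in ⋃ k : ℤ, f ⁻¹' Set.Ico (lam ^ k) (lam ^ (k + 1)), ENNReal.ofReal (f y) ^ p ∂ν :=
        (lintegral_iUnion hms hdisj _).symm
    _ ≤ _ := setLIntegral_le_lintegral _ _

/-- The integral against a function is controlled by the integrals over its levels. -/
lemma lintegral_ofReal_mul_le_tsum_level {Y : Type*} [MeasurableSpace Y] {ν : Measure Y} {lam : ℝ}
    (hlam : 1 < lam) {f : Y → ℝ} (hf : Measurable f) {H : Y → ENNReal} (hH : Measurable H) :
    ∫⁻ y, ENNReal.ofReal (f y) * H y ∂ν ≤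
      ∑' k : ℤ, ENNReal.ofReal (lam ^ (k + 1)) *
        ∫⁻ y in f ⁻¹' Set.Ico (lam ^ k) (lam ^ (k + 1)), H y ∂ν := by
  have hms : ∀ k : ℤ, MeasurableSet (f ⁻¹' Set.Ico (lam ^ k) (lam ^ (k + 1))) :=
    fun k => hf measurableSet_Ico
  calc ∫⁻ y, ENNReal.ofReal (f y) * H y ∂ν
      ≤ ∫⁻ y, ∑' k : ℤ, ENNReal.ofReal (lam ^ (k + 1)) *
          (f ⁻¹' Set.Ico (lam ^ k) (lam ^ (k + 1))).indicator H y ∂ν := by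
        refine lintegral_mono fun y => ?_
        refine (mul_le_mul_left (ofReal_le_tsum_indicator hlam f y) (H y)).trans_eq ?_
        rw [← ENNReal.tsum_mul_right]
        refine tsum_congr fun k => ?_
        by_cases hy : y ∈ f ⁻¹' Set.Ico (lam ^ k) (lam ^ (k + 1)) <;> simp [hy]
    _ = _ := by
        rw [lintegral_tsum fun k => ((hH.indicator (hms k)).const_mul _).aemeasurable]
        refine tsum_congr fun k => ?_
        rw [lintegral_const_mul _ (hH.indicator (hms k)), lintegral_indicator (hms k)]

/-- A product of powers with exponents summing to at least `1` of numbers in `[0, 1]`, with the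
dyadic scales factored out. -/
lemma two_rpow_mul_two_rpow_mul_le {φ ψ X C : ENNReal} {u w k l s t : ℝ} (hφ : φ ≤ 1) (hψ : ψ ≤ 1)
    (hs : 0 ≤ s) (ht : 0 ≤ t) (hst : 1 ≤ s + t)
    (hX : X ≤ C * (φ * ENNReal.ofReal (2 ^ (-k))) ^ s * (ψ * ENNReal.ofReal (2 ^ (-l))) ^ t) :
    ENNReal.ofReal (2 ^ u) * ENNReal.ofReal (2 ^ w) * X ≤
      C * ((φ + ψ) * ENNReal.ofReal (2 ^ (u + w - k * s - l * t))) := by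
  have hprod : φ ^ s * ψ ^ t ≤ φ + ψ := by
    calc φ ^ s * ψ ^ t ≤ (max φ ψ) ^ s * (max φ ψ) ^ t := by
          gcongr
          · exact le_max_left _ _
          · exact le_max_right _ _
      _ = (max φ ψ) ^ (s + t) := (ENNReal.rpow_add_of_nonneg _ _ hs ht).symm
      _ ≤ max φ ψ := ENNReal.rpow_le_self_of_le_one (max_le hφ hψ) hst
      _ ≤ φ + ψ := max_le le_self_add le_add_self
  have hpow : ∀ x y : ℝ, 0 ≤ y →
      ENNReal.ofReal ((2 : ℝ) ^ (-x)) ^ y = ENNReal.ofReal (2 ^ (-(x * y))) := by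
    intro x y hy
    rw [ENNReal.ofReal_rpow_of_nonneg (by positivity) hy, ← Real.rpow_mul (by norm_num), neg_mul]
  calc ENNReal.ofReal (2 ^ u) * ENNReal.ofReal (2 ^ w) * X
      ≤ ENNReal.ofReal (2 ^ u) * ENNReal.ofReal (2 ^ w) *
        (C * (φ * ENNReal.ofReal (2 ^ (-k))) ^ s * (ψ * ENNReal.ofReal (2 ^ (-l))) ^ t) := by gcongr
    _ = C * ((φ ^ s * ψ ^ t) * (ENNReal.ofReal (2 ^ u) * ENNReal.ofReal (2 ^ w) *
          ENNReal.ofReal (2 ^ (-(k * s))) * ENNReal.ofReal (2 ^ (-(l * t))))) := by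
        rw [ENNReal.mul_rpow_of_nonneg _ _ hs, ENNReal.mul_rpow_of_nonneg _ _ ht, hpow _ _ hs,
          hpow _ _ ht]
        ring
    _ = C * ((φ ^ s * ψ ^ t) * ENNReal.ofReal (2 ^ (u + w - k * s - l * t))) := by
        rw [← ENNReal.ofReal_mul (by positivity), ← ENNReal.ofReal_mul (by positivity),
          ← ENNReal.ofReal_mul (by positivity), ← Real.rpow_add (by norm_num),
          ← Real.rpow_add (by norm_num), ← Real.rpow_add (by norm_num), sub_eq_add_neg,
          sub_eq_add_neg]
    _ ≤ _ := by gcongr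

/-- Off-diagonal bilinear interpolation: two estimates of restricted type, at exponents on both
sides of `(1 / p, 1 / q)`, imply a strong type estimate. -/
theorem exists_lintegral_lintegral_le_of_restricted_type {X Y : Type*} [MeasurableSpace X]
    [MeasurableSpace Y] {μ : Measure X} {ν : Measure Y} [SFinite μ] [SFinite ν]
    {K : X → Y → ENNReal} (hK : Measurable (Function.uncurry K)) {p q δ ε : ℝ} (hp : 0 < p)
    (hq : 0 < q) (hδ : 0 < δ) (hε : 0 < ε) (hδp : δ ≤ 1 / p) (hεq : ε ≤ 1 / q)
    (h1 : 1 ≤ (1 / p + δ) + (1 / q - ε)) (h2 : 1 ≤ (1 / p - δ) + (1 / q + ε))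
    {C : ENNReal} (hC : C ≠ ⊤)
    (hr1 : ∀ E F, MeasurableSet E → MeasurableSet F → ∫⁻ x in E, ∫⁻ y in F, K x y ∂ν ∂μ ≤
      C * ν F ^ (1 / p + δ) * μ E ^ (1 / q - ε))
    (hr2 : ∀ E F, MeasurableSet E → MeasurableSet F → ∫⁻ x in E, ∫⁻ y in F, K x y ∂ν ∂μ ≤
      C * ν F ^ (1 / p - δ) * μ E ^ (1 / q + ε)) :
    ∃ D : ENNReal, D ≠ ⊤ ∧ ∀ (f : Y → ℝ) (g : X → ℝ), Measurable f → Measurable g →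
      ∫⁻ y, ENNReal.ofReal (f y) ^ p ∂ν ≤ 1 → ∫⁻ x, ENNReal.ofReal (g x) ^ q ∂μ ≤ 1 →
      ∫⁻ x, ENNReal.ofReal (g x) * ∫⁻ y, ENNReal.ofReal (f y) * K x y ∂ν ∂μ ≤ D := by
  -- The ratios are chosen so that `(lam ^ k) ^ (p * δ) = 2 ^ k` and `(eta ^ l) ^ (q * ε) = 2 ^ l`;
  -- the two hypotheses then yield the factors `2 ^ (l - k)` and `2 ^ (k - l)`.
  set lam : ℝ := 2 ^ (1 / (p * δ)) with hlam
  set eta : ℝ := 2 ^ (1 / (q * ε)) with heta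
  have hlam1 : 1 < lam := Real.one_lt_rpow (by norm_num) (by positivity)
  have heta1 : 1 < eta := Real.one_lt_rpow (by norm_num) (by positivity)
  have hlamk : ∀ k : ℤ, lam ^ k = 2 ^ (k / (p * δ)) := fun k => by
    rw [hlam, ← Real.rpow_intCast, ← Real.rpow_mul (by norm_num)]; ring_nf
  have hetal : ∀ l : ℤ, eta ^ l = 2 ^ (l / (q * ε)) := fun l => by
    rw [heta, ← Real.rpow_intCast, ← Real.rpow_mul (by norm_num)]; ring_nf
  set S : ENNReal := ∑' k : ℤ, ENNReal.ofReal ((2 : ℝ) ^ (-|(k : ℝ)|)) with hS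
  have hStop : S ≠ ⊤ := tsum_two_rpow_neg_abs_ne_top
  refine ⟨ENNReal.ofReal eta * ENNReal.ofReal lam * C * (S + S),
    ENNReal.mul_ne_top (ENNReal.mul_ne_top (ENNReal.mul_ne_top ENNReal.ofReal_ne_top
      ENNReal.ofReal_ne_top) hC) (ENNReal.add_ne_top.2 ⟨hStop, hStop⟩), ?_⟩
  intro f g hf hg hf1 hg1
  set F : ℤ → Set Y := fun k => f ⁻¹' Set.Ico (lam ^ k) (lam ^ (k + 1)) with hF
  set E : ℤ → Set X := fun l => g ⁻¹' Set.Ico (eta ^ l) (eta ^ (l + 1)) with hE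
  have hFm : ∀ k, MeasurableSet (F k) := fun k => hf measurableSet_Ico
  have hEm : ∀ k, MeasurableSet (E k) := fun k => hg measurableSet_Ico
  set φ : ℤ → ENNReal := fun k => ENNReal.ofReal ((lam ^ k) ^ p) * ν (F k) with hφ
  set ψ : ℤ → ENNReal := fun l => ENNReal.ofReal ((eta ^ l) ^ q) * μ (E l) with hψ
  have hφsum : ∑' k, φ k ≤ 1 := (tsum_measure_level_le hlam1 hp hf).trans hf1
  have hψsum : ∑' l, ψ l ≤ 1 := (tsum_measure_level_le heta1 hq hg).trans hg1
  have hφ1 : ∀ k, φ k ≤ 1 := fun k => (ENNReal.le_tsum k).trans hφsum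
  have hψ1 : ∀ k, ψ k ≤ 1 := fun k => (ENNReal.le_tsum k).trans hψsum
  have hνF : ∀ k, ν (F k) = φ k * ENNReal.ofReal (2 ^ (-((k : ℝ) / δ))) := fun k => by
    rw [hφ]
    dsimp only
    rw [mul_right_comm, ← ENNReal.ofReal_mul (by positivity), hlamk, ← Real.rpow_mul (by norm_num),
      ← Real.rpow_add (by norm_num), show (k : ℝ) / (p * δ) * p + -((k : ℝ) / δ) = 0 by
        field_simp; ring]
    simp
  have hμE : ∀ l, μ (E l) = ψ l * ENNReal.ofReal (2 ^ (-((l : ℝ) / ε))) := fun l => by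
    rw [hψ]
    dsimp only
    rw [mul_right_comm, ← ENNReal.ofReal_mul (by positivity), hetal, ← Real.rpow_mul (by norm_num),
      ← Real.rpow_add (by norm_num), show (l : ℝ) / (q * ε) * q + -((l : ℝ) / ε) = 0 by
        field_simp; ring]
    simp
  have hterm : ∀ k l : ℤ, ENNReal.ofReal (lam ^ k) * ENNReal.ofReal (eta ^ l) *
      ∫⁻ x in E l, ∫⁻ y in F k, K x y ∂ν ∂μ ≤
        C * ((φ k + ψ l) * ENNReal.ofReal (2 ^ (-|((k - l : ℤ) : ℝ)|))) := by
    intro k l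
    have i1 := hr1 (E l) (F k) (hEm l) (hFm k)
    have i2 := hr2 (E l) (F k) (hEm l) (hFm k)
    rw [hνF, hμE] at i1 i2
    rw [hlamk, hetal]
    -- The sign of `k - l` decides which of the two estimates decays.
    rcases le_total l k with hkl | hkl
    · refine (two_rpow_mul_two_rpow_mul_le (hφ1 k) (hψ1 l) (by positivity) (by linarith) h1
        i1).trans_eq ?_
      have hkl' : (0 : ℝ) ≤ ((k - l : ℤ) : ℝ) := by exact_mod_cast sub_nonneg.2 hkl
      rw [abs_of_nonneg hkl']
      congr 4
      push_cast
      field_simp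
      ring
    · refine (two_rpow_mul_two_rpow_mul_le (hφ1 k) (hψ1 l) (by linarith) (by positivity) h2
        i2).trans_eq ?_
      have hkl' : ((k - l : ℤ) : ℝ) ≤ 0 := by exact_mod_cast sub_nonpos.2 hkl
      rw [abs_of_nonpos hkl']
      congr 4
      push_cast
      field_simp
      ring
  have hKF : ∀ k, Measurable fun x => ∫⁻ y in F k, K x y ∂ν := fun k => hK.lintegral_prod_right'
  have hH : Measurable fun x => ∫⁻ y, ENNReal.ofReal (f y) * K x y ∂ν :=
    Measurable.lintegral_prod_right' (f := fun z : X × Y => ENNReal.ofReal (f z.2) * K z.1 z.2)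
      (((hf.comp measurable_snd).ennreal_ofReal).mul hK)
  have hlams : ∀ k : ℤ, ENNReal.ofReal (lam ^ (k + 1)) =
      ENNReal.ofReal lam * ENNReal.ofReal (lam ^ k) := fun k => by
    rw [← ENNReal.ofReal_mul (by positivity), zpow_add_one₀ (by positivity), mul_comm]
  have hetas : ∀ k : ℤ, ENNReal.ofReal (eta ^ (k + 1)) =
      ENNReal.ofReal eta * ENNReal.ofReal (eta ^ k) := fun k => by
    rw [← ENNReal.ofReal_mul (by positivity), zpow_add_one₀ (by positivity), mul_comm]
  calc ∫⁻ x, ENNReal.ofReal (g x) * ∫⁻ y, ENNReal.ofReal (f y) * K x y ∂ν ∂μ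
      ≤ ∑' l : ℤ, ENNReal.ofReal (eta ^ (l + 1)) *
          ∫⁻ x in E l, ∫⁻ y, ENNReal.ofReal (f y) * K x y ∂ν ∂μ :=
        lintegral_ofReal_mul_le_tsum_level heta1 hg hH
    _ ≤ ∑' l : ℤ, ENNReal.ofReal (eta ^ (l + 1)) *
          ∑' k : ℤ, ENNReal.ofReal (lam ^ (k + 1)) * ∫⁻ x in E l, ∫⁻ y in F k, K x y ∂ν ∂μ := by
        gcongr with l
        calc ∫⁻ x in E l, ∫⁻ y, ENNReal.ofReal (f y) * K x y ∂ν ∂μ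
            ≤ ∫⁻ x in E l, ∑' k : ℤ, ENNReal.ofReal (lam ^ (k + 1)) *
                ∫⁻ y in F k, K x y ∂ν ∂μ :=
              lintegral_mono fun x => lintegral_ofReal_mul_le_tsum_level hlam1 hf
                (hK.comp measurable_prodMk_left)
          _ = _ := by
              rw [lintegral_tsum fun k => ((hKF k).const_mul _).aemeasurable]
              exact tsum_congr fun k => lintegral_const_mul _ (hKF k)
    _ = ENNReal.ofReal eta * ENNReal.ofReal lam * ∑' l : ℤ, ∑' k : ℤ,
          ENNReal.ofReal (lam ^ k) * ENNReal.ofReal (eta ^ l) *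
            ∫⁻ x in E l, ∫⁻ y in F k, K x y ∂ν ∂μ := by
        simp_rw [← ENNReal.tsum_mul_left]
        refine tsum_congr fun l => tsum_congr fun k => ?_
        rw [hlams, hetas]
        ring
    _ ≤ ENNReal.ofReal eta * ENNReal.ofReal lam * ∑' l : ℤ, ∑' k : ℤ,
          C * ((φ k + ψ l) * ENNReal.ofReal (2 ^ (-|((k - l : ℤ) : ℝ)|))) := by
        exact mul_le_mul' le_rfl
          (ENNReal.tsum_le_tsum fun l => ENNReal.tsum_le_tsum fun k => hterm k l)
    _ = ENNReal.ofReal eta * ENNReal.ofReal lam * C *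
          ((∑' k, φ k) * S + (∑' l, ψ l) * S) := by
        rw [mul_assoc _ C]
        congr 1
        simp_rw [ENNReal.tsum_mul_left, add_mul, ENNReal.tsum_add]
        congr 2
        -- By translation invariance on `ℤ`, summing the decay over the other index always gives
        -- `S`.
        · rw [ENNReal.tsum_comm, ← ENNReal.tsum_mul_right]
          refine tsum_congr fun k => ?_
          rw [ENNReal.tsum_mul_left]
          congr 1
          exact (Equiv.subLeft k).tsum_eq fun m : ℤ => ENNReal.ofReal ((2 : ℝ) ^ (-|(m : ℝ)|))
        · rw [← ENNReal.tsum_mul_right]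
          refine tsum_congr fun l => ?_
          rw [ENNReal.tsum_mul_left]
          congr 1
          exact (Equiv.subRight l).tsum_eq fun m : ℤ => ENNReal.ofReal ((2 : ℝ) ^ (-|(m : ℝ)|))
    _ ≤ ENNReal.ofReal eta * ENNReal.ofReal lam * C * (1 * S + 1 * S) := by gcongr
    _ = _ := by rw [one_mul]

/-! ### Restricted type estimates on the half space -/

instance (n : ℕ) : (volume : Measure (Point n)).IsAddHaarMeasure :=
  inferInstanceAs ((volume : Measure (Boundary n)).prod (volume : Measure ℝ)).IsAddHaarMeasure

instance (n : ℕ) : SFinite (halfSpaceMeasure n) := by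
  unfold halfSpaceMeasure
  infer_instance

lemma measurableSet_upperHalfSpace (n : ℕ) : MeasurableSet (upperHalfSpace n) :=
  measurable_snd measurableSet_Ioi

lemma ae_halfSpaceMeasure_snd_pos (n : ℕ) : ∀ᵐ x ∂(halfSpaceMeasure n), 0 < x.2 :=
  ae_restrict_mem (measurableSet_upperHalfSpace n)

lemma measurable_euclNorm (n : ℕ) : Measurable (euclNorm (n := n)) := by
  unfold euclNorm
  fun_prop

lemma measurable_poissonKernel (n : ℕ) (γ : ℝ) :
    Measurable fun z : Point n × Boundary n => poissonKernel z.1 z.2 γ := by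
  unfold poissonKernel
  fun_prop

lemma measurable_weighted_poissonKernel (n : ℕ) (α β : ℝ) :
    Measurable fun z : Point n × Boundary n =>
      ‖z.2‖ ^ (-α) * poissonKernel z.1 z.2 2 * euclNorm z.1 ^ β :=
  (((measurable_snd.norm).pow_const _).mul (measurable_poissonKernel n 2)).mul
    (((measurable_euclNorm n).comp measurable_fst).pow_const _)

/-- Negative powers of the distance over subsets of the half space. -/
lemma exists_setLIntegral_halfSpaceMeasure_le {n : ℕ} (hn : 1 ≤ n) {θ : ℝ} (hθ : 0 < θ)
    (hθ1 : θ < 1) :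
    ∃ C : ENNReal, C ≠ ⊤ ∧ ∀ (a : Point n) (E : Set (Point n)), MeasurableSet E →
      ∫⁻ x in E, ENNReal.ofReal (‖x - a‖ ^ (-(θ * n))) ∂(halfSpaceMeasure n) ≤
        C * halfSpaceMeasure n E ^ (1 - θ) := by
  obtain ⟨C, hC, h⟩ := exists_setLIntegral_norm_sub_rpow_le
    (volume : Measure (Point n)) hθ hθ1
  have hfr : Module.finrank ℝ (Point n) = n := by
    simp only [Module.finrank_prod, finrank_euclideanSpace, Fintype.card_fin, Module.finrank_self]
    omega
  rw [hfr] at h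
  refine ⟨C, hC, fun a E hE => ?_⟩
  rw [halfSpaceMeasure, Measure.restrict_restrict hE, Measure.restrict_apply hE]
  exact h a _

/-- The restricted type estimate for the Poisson kernel. -/
lemma exists_restricted_poissonKernel_le {n : ℕ} (hn : 2 ≤ n) {ρ : ℝ} (hρ : 0 ≤ ρ) (hρ1 : ρ ≤ 1) :
    ∃ C : ENNReal, C ≠ ⊤ ∧ ∀ (E : Set (Point n)) (F : Set (Boundary n)),
      MeasurableSet E → MeasurableSet F →
      ∫⁻ x in E, ∫⁻ ξ in F, ENNReal.ofReal (poissonKernel x ξ 2) ∂volume ∂(halfSpaceMeasure n) ≤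
        C * volume F ^ ρ * halfSpaceMeasure n E ^ (1 - ((n : ℝ) - 1) / n * ρ) := by
  have hn0 : (2 : ℝ) ≤ n := by exact_mod_cast hn
  have hθ : 0 < ((n : ℝ) - 1) / n := div_pos (by linarith) (by linarith)
  have hθ1 : ((n : ℝ) - 1) / n < 1 := by rw [div_lt_one] <;> linarith
  obtain ⟨A, hA, hA'⟩ := exists_lintegral_poissonKernel_le n (by omega)
  obtain ⟨B, hB, hB'⟩ := exists_setLIntegral_halfSpaceMeasure_le (n := n) (by omega) hθ hθ1
  refine ⟨A ^ (1 - ρ) * B ^ ρ, ENNReal.mul_ne_top (ENNReal.rpow_ne_top_of_nonneg (by linarith) hA)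
    (ENNReal.rpow_ne_top_of_nonneg hρ hB), fun E F hE hF => ?_⟩
  set I := ∫⁻ x in E, ∫⁻ ξ in F, ENNReal.ofReal (poissonKernel x ξ 2) ∂volume ∂(halfSpaceMeasure n)
  have hpos := ae_restrict_of_ae (s := E) (ae_halfSpaceMeasure_snd_pos n)
  -- The endpoint `ρ = 0`.
  have i1 : I ≤ A * halfSpaceMeasure n E := by
    rw [← setLIntegral_const]
    refine lintegral_mono_ae ?_
    filter_upwards [hpos] with x hx
    exact (setLIntegral_le_lintegral _ _).trans (hA' x hx)
  -- The endpoint `ρ = 1`, integrating over `x` first.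
  have i2 : I ≤ B * halfSpaceMeasure n E ^ (1 - ((n : ℝ) - 1) / n) * volume F := by
    have hm := (measurable_poissonKernel n 2).ennreal_ofReal
    calc I = ∫⁻ ξ in F, ∫⁻ x in E, ENNReal.ofReal (poissonKernel x ξ 2) ∂(halfSpaceMeasure n) :=
          lintegral_lintegral_swap hm.aemeasurable
      _ ≤ ∫⁻ _ in F, B * halfSpaceMeasure n E ^ (1 - ((n : ℝ) - 1) / n) := by
          refine lintegral_mono fun ξ => ?_
          refine le_trans (lintegral_mono_ae ?_) (hB' (ξ, 0) E hE)
          filter_upwards [hpos] with x hx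
          refine ENNReal.ofReal_le_ofReal ((poissonKernel_le_norm_sub_rpow hx ξ).trans_eq ?_)
          rw [div_mul_cancel₀]
          linarith
      _ = _ := setLIntegral_const _ _
  calc I = I ^ (1 - ρ) * I ^ ρ := by
        rw [← ENNReal.rpow_add_of_nonneg _ _ (by linarith) hρ]
        simp
    _ ≤ (A * halfSpaceMeasure n E) ^ (1 - ρ) *
        (B * halfSpaceMeasure n E ^ (1 - ((n : ℝ) - 1) / n) * volume F) ^ ρ := by
        gcongr
    _ = A ^ (1 - ρ) * B ^ ρ * volume F ^ ρ * (halfSpaceMeasure n E ^ (1 - ρ) *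
          halfSpaceMeasure n E ^ ((1 - ((n : ℝ) - 1) / n) * ρ)) := by
        rw [ENNReal.mul_rpow_of_nonneg _ _ hρ, ENNReal.mul_rpow_of_nonneg _ _ hρ,
          ENNReal.mul_rpow_of_nonneg _ _ (sub_nonneg.2 hρ1), ENNReal.rpow_mul]
        ring
    _ = _ := by
        rw [← ENNReal.rpow_add_of_nonneg _ _ (sub_nonneg.2 hρ1)
          (mul_nonneg (by linarith) hρ)]
        ring_nf

/-- The restricted type estimate for the weighted Poisson kernel. -/
lemma exists_restricted_weighted_poissonKernel_le {n : ℕ} (hn : 2 ≤ n) {α ρ : ℝ} (hρ : 0 < ρ)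
    (hρ1 : ρ < 1) (h1 : α ≤ ((n : ℝ) - 1) * (1 - ρ)) (h2 : -α ≤ 1 + ((n : ℝ) - 1) * ρ) :
    ∃ C : ENNReal, C ≠ ⊤ ∧ ∀ (E : Set (Point n)) (F : Set (Boundary n)),
      MeasurableSet E → MeasurableSet F →
      ∫⁻ x in E, ∫⁻ ξ in F, ENNReal.ofReal (‖ξ‖ ^ (-α) * poissonKernel x ξ 2 * euclNorm x ^ α) ∂volume
          ∂(halfSpaceMeasure n) ≤
        C * volume F ^ ρ * halfSpaceMeasure n E ^ (1 - ((n : ℝ) - 1) / n * ρ) := by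
  have hn0 : (2 : ℝ) ≤ n := by exact_mod_cast hn
  have hn1 : 0 < ((n : ℝ) - 1) / n := div_pos (by linarith) (by linarith)
  have hn2 : ((n : ℝ) - 1) / n < 1 := by rw [div_lt_one] <;> linarith
  have : Nontrivial (Boundary n) := by
    have : Nonempty (Fin (n - 1)) := ⟨⟨0, by omega⟩⟩
    infer_instance
  have hfr : (Module.finrank ℝ (Boundary n) : ℝ) = n - 1 := by
    simp [Nat.cast_sub (show 1 ≤ n by omega)]
  -- Both exponents have the form `θ` times dimension required by the rearrangement bound: `θ = 1 -
  -- ρ` on the boundary, `θ = (n - 1) / n * ρ` in the half space.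
  obtain ⟨M, hM, hK⟩ := exists_weighted_poissonKernel_le n (α := α)
    (c := (1 - ρ) * ((n : ℝ) - 1)) (d := ((n : ℝ) - 1) / n * ρ * n) (by field_simp; ring)
    (by positivity) (by linarith) (by
      rw [show ((n : ℝ) - 1) / n * ρ * n = ((n : ℝ) - 1) * ρ by field_simp]
      exact h2)
  obtain ⟨A, hA, hA'⟩ := exists_restricted_poissonKernel_le hn hρ.le hρ1.le
  obtain ⟨B, hB, hB'⟩ := exists_setLIntegral_norm_sub_rpow_le (volume : Measure (Boundary n))
    (sub_pos.2 hρ1) (sub_lt_self 1 hρ)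
  obtain ⟨D, hD, hD'⟩ := exists_setLIntegral_halfSpaceMeasure_le (n := n) (by omega)
    (θ := ((n : ℝ) - 1) / n * ρ) (by positivity) (by nlinarith)
  rw [hfr] at hB'
  refine ⟨ENNReal.ofReal M * (B * D + A), ENNReal.mul_ne_top ENNReal.ofReal_ne_top
    (ENNReal.add_ne_top.2 ⟨ENNReal.mul_ne_top hB hD, hA⟩), fun E F hE hF => ?_⟩
  have hpos := ae_restrict_of_ae (s := E) (ae_halfSpaceMeasure_snd_pos n)
  have hne : ∀ᵐ ξ : Boundary n ∂(volume.restrict F), ξ ≠ 0 :=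
    ae_restrict_of_ae (Measure.ae_ne volume 0)
  have hmP := (measurable_poissonKernel n 2).ennreal_ofReal
  set u : Boundary n → ENNReal := fun ξ => ENNReal.ofReal (‖ξ‖ ^ (-((1 - ρ) * ((n : ℝ) - 1))))
  set v : Point n → ENNReal := fun x => ENNReal.ofReal (‖x‖ ^ (-(((n : ℝ) - 1) / n * ρ * n)))
  have hu : Measurable u := by fun_prop
  have hv : Measurable v := by fun_prop
  have hb : ∫⁻ ξ in F, u ξ ≤ B * volume F ^ ρ := by simpa using hB' 0 F
  have hd : ∫⁻ x in E, v x ∂(halfSpaceMeasure n) ≤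
      D * halfSpaceMeasure n E ^ (1 - ((n : ℝ) - 1) / n * ρ) := by simpa using hD' 0 E hE
  calc ∫⁻ x in E, ∫⁻ ξ in F, ENNReal.ofReal (‖ξ‖ ^ (-α) * poissonKernel x ξ 2 * euclNorm x ^ α) ∂volume
          ∂(halfSpaceMeasure n)
      ≤ ∫⁻ x in E, ENNReal.ofReal M * (v x * (∫⁻ ξ in F, u ξ) +
          ∫⁻ ξ in F, ENNReal.ofReal (poissonKernel x ξ 2)) ∂(halfSpaceMeasure n) := by
        refine lintegral_mono_ae ?_
        filter_upwards [hpos] with x hx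
        rw [← lintegral_const_mul _ hu, ← lintegral_add_left (hu.const_mul _),
          ← lintegral_const_mul' _ _ ENNReal.ofReal_ne_top]
        refine lintegral_mono_ae ?_
        filter_upwards [hne] with ξ hξ
        refine (ENNReal.ofReal_le_ofReal (hK x ξ hx hξ)).trans_eq ?_
        rw [ENNReal.ofReal_mul hM, ENNReal.ofReal_add (by positivity) (poissonKernel_nonneg hx ξ 2),
          ENNReal.ofReal_mul (by positivity), mul_comm (u ξ)]
    _ = ENNReal.ofReal M * ((∫⁻ x in E, v x ∂(halfSpaceMeasure n)) * (∫⁻ ξ in F, u ξ) +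
          ∫⁻ x in E, ∫⁻ ξ in F, ENNReal.ofReal (poissonKernel x ξ 2) ∂volume ∂(halfSpaceMeasure n)) := by
        rw [lintegral_const_mul' _ _ ENNReal.ofReal_ne_top,
          lintegral_add_left (hv.mul_const _), lintegral_mul_const _ hv]
    _ ≤ ENNReal.ofReal M * ((D * halfSpaceMeasure n E ^ (1 - ((n : ℝ) - 1) / n * ρ)) *
          (B * volume F ^ ρ) +
          A * volume F ^ ρ * halfSpaceMeasure n E ^ (1 - ((n : ℝ) - 1) / n * ρ)) := by
        gcongr
        exact hA' E F hE hF
    _ = _ := by ring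

/-! ### The strong type estimate -/

/-- An `Lᵖ` function is dominated by its norm times a function in the unit ball. -/
lemma exists_normalized_of_memLp {Y : Type*} [MeasurableSpace Y] {ν : Measure Y} {p : ℝ}
    (hp : 0 < p) {f : Y → ℝ} (hf : MemLp f (ENNReal.ofReal p) ν) :
    ∃ h : Y → ℝ, Measurable h ∧ ∫⁻ y, ENNReal.ofReal (h y) ^ p ∂ν ≤ 1 ∧
      ∀ᵐ y ∂ν, ‖f y‖ₑ ≤ eLpNorm f (ENNReal.ofReal p) ν * ENNReal.ofReal (h y) := by
  have hp0 : ENNReal.ofReal p ≠ 0 := by simpa using hp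
  rcases eq_or_ne (eLpNorm f (ENNReal.ofReal p) ν) 0 with h0 | h0
  · refine ⟨0, measurable_zero, by simp [hp], ?_⟩
    filter_upwards [(eLpNorm_eq_zero_iff hf.1 hp0).1 h0] with y hy
    simp [hy]
  have htop := hf.eLpNorm_ne_top
  have hNp : eLpNorm f (ENNReal.ofReal p) ν ^ p = ∫⁻ y, ‖f y‖ₑ ^ p ∂ν := by
    rw [eLpNorm_eq_lintegral_rpow_enorm_toReal hp0 ENNReal.ofReal_ne_top,
      ENNReal.toReal_ofReal hp.le, ← ENNReal.rpow_mul, one_div_mul_cancel hp.ne', ENNReal.rpow_one]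
  set N := eLpNorm f (ENNReal.ofReal p) ν
  have hN : 0 < N.toReal := ENNReal.toReal_pos h0 htop
  have hdiv : ∀ t : ℝ, ENNReal.ofReal (|t| / N.toReal) = ‖t‖ₑ / N := fun t => by
    rw [ENNReal.ofReal_div_of_pos hN, ENNReal.ofReal_toReal htop, Real.enorm_eq_ofReal_abs]
  -- The interpolation cuts along level sets, so a genuinely measurable representative is needed.
  have hmk := hf.1.ae_eq_mk
  have hmeas : Measurable (hf.1.mk f) := hf.1.stronglyMeasurable_mk.measurable
  refine ⟨fun y => |hf.1.mk f y| / N.toReal, hmeas.abs.div_const _, ?_, ?_⟩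
  · calc ∫⁻ y, ENNReal.ofReal (|hf.1.mk f y| / N.toReal) ^ p ∂ν
        = ∫⁻ y, (N ^ p)⁻¹ * ‖f y‖ₑ ^ p ∂ν := by
          refine lintegral_congr_ae ?_
          filter_upwards [hmk] with y hy
          rw [hdiv, ← hy, ENNReal.div_rpow_of_nonneg _ _ hp.le, mul_comm, div_eq_mul_inv]
      _ = (N ^ p)⁻¹ * N ^ p := by
          rw [lintegral_const_mul' _ _ (ENNReal.inv_ne_top.2 (by simp [h0, hp, htop])), hNp]
      _ ≤ 1 := ENNReal.inv_mul_le_one _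
  · filter_upwards [hmk] with y hy
    rw [hdiv, ← hy, ENNReal.mul_div_cancel h0 htop]

/-- The weighted bilinear estimate with absolute values inside the integral. -/
theorem exists_lintegral_weighted_poissonKernel_le {n : ℕ} (hn : 2 ≤ n) {p q α : ℝ} (hp : 1 < p)
    (hq : 1 < q) (h1 : α < ((n : ℝ) - 1) * (1 - 1 / p)) (h2 : -α < 1 + ((n : ℝ) - 1) * (1 / p))
    (hscale : ((n : ℝ) - 1) / n * (1 / p) + 1 / q = 1) :
    ∃ D : ENNReal, D ≠ ⊤ ∧ ∀ (f : Boundary n → ℝ) (g : Point n → ℝ),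
      MemLp f (ENNReal.ofReal p) volume → MemLp g (ENNReal.ofReal q) (halfSpaceMeasure n) →
      ∫⁻ x, ‖g x‖ₑ * ∫⁻ ξ, ‖f ξ‖ₑ *
          ENNReal.ofReal (‖ξ‖ ^ (-α) * poissonKernel x ξ 2 * euclNorm x ^ α) ∂volume
          ∂(halfSpaceMeasure n) ≤
        D * eLpNorm g (ENNReal.ofReal q) (halfSpaceMeasure n) *
          eLpNorm f (ENNReal.ofReal p) volume := by
  have hn0 : (2 : ℝ) ≤ n := by exact_mod_cast hn
  have hn1 : 0 < (n : ℝ) - 1 := by linarith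
  have hm : 0 < ((n : ℝ) - 1) / n := by positivity
  have hm1 : ((n : ℝ) - 1) / n < 1 := by rw [div_lt_one] <;> linarith
  have ha : 0 < 1 / p := by positivity
  have ha1 : 1 / p < 1 := by rw [div_lt_one] <;> linarith
  -- Every condition holds strictly at `δ = 0` and is continuous in `δ`, hence survives for small
  -- positive `δ`.
  obtain ⟨δ, hδ, hδa, hδa1, hδ1, hδ2⟩ : ∃ δ : ℝ, 0 < δ ∧ δ < 1 / p ∧ 1 / p + δ < 1 ∧
      α ≤ ((n : ℝ) - 1) * (1 - (1 / p + δ)) ∧ -α ≤ 1 + ((n : ℝ) - 1) * (1 / p - δ) := by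
    have c1 : ∀ᶠ δ : ℝ in nhdsWithin 0 (Set.Ioi 0), 0 < δ := self_mem_nhdsWithin
    have ev : ∀ {u : ℝ → ℝ} {c : ℝ}, Continuous u → u 0 < c →
        ∀ᶠ δ : ℝ in nhdsWithin 0 (Set.Ioi 0), u δ < c := fun hu h =>
      (hu.continuousAt.eventually_lt continuousAt_const h).filter_mono nhdsWithin_le_nhds
    have c2 := ev (u := fun δ => δ) (c := 1 / p) (by fun_prop) ha
    have c3 := ev (u := fun δ => 1 / p + δ) (c := 1) (by fun_prop) (by simpa using ha1)
    have c4 := ev (u := fun δ => α - ((n : ℝ) - 1) * (1 - (1 / p + δ))) (c := 0) (by fun_prop)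
      (by simp only [add_zero]; linarith)
    have c5 := ev (u := fun δ => -α - (1 + ((n : ℝ) - 1) * (1 / p - δ))) (c := 0) (by fun_prop)
      (by simp only [sub_zero]; linarith)
    obtain ⟨δ, d1, d2, d3, d4, d5⟩ := (c1.and (c2.and (c3.and (c4.and c5)))).exists
    exact ⟨δ, d1, d2, d3, by linarith, by linarith⟩
  obtain ⟨A, hA, hA'⟩ := exists_restricted_weighted_poissonKernel_le hn (ρ := 1 / p + δ)
    (by linarith) hδa1 hδ1 (by nlinarith)
  obtain ⟨B, hB, hB'⟩ := exists_restricted_weighted_poissonKernel_le hn (ρ := 1 / p - δ)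
    (by linarith) (by linarith) (by nlinarith) hδ2
  set m : ℝ := ((n : ℝ) - 1) / n
  have e1 : 1 - m * (1 / p + δ) = 1 / q - m * δ := by linarith
  have e2 : 1 - m * (1 / p - δ) = 1 / q + m * δ := by linarith
  rw [e1] at hA'
  rw [e2] at hB'
  have hK := (measurable_weighted_poissonKernel n α α).ennreal_ofReal
  -- The scaling relation forces `ε = m * δ`. The exponent sums are `1 + (1 - m) * (1 / p ± δ)`, at
  -- least `1` since `m < 1` and `δ < 1 / p`.
  obtain ⟨D, hD, hD'⟩ := exists_lintegral_lintegral_le_of_restricted_type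
    (μ := halfSpaceMeasure n) (ν := (volume : Measure (Boundary n)))
    (K := fun x ξ => ENNReal.ofReal (‖ξ‖ ^ (-α) * poissonKernel x ξ 2 * euclNorm x ^ α)) hK
    (p := p) (q := q) (δ := δ) (ε := m * δ) (C := A + B)
    (by linarith) (by linarith) hδ (by positivity) hδa.le (by nlinarith) (by nlinarith)
    (by nlinarith) (ENNReal.add_ne_top.2 ⟨hA, hB⟩)
    (fun E F hE hF => (hA' E F hE hF).trans (by gcongr; exact le_self_add))
    (fun E F hE hF => (hB' E F hE hF).trans (by gcongr; exact le_add_self))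
  refine ⟨D, hD, fun f g hf hg => ?_⟩
  obtain ⟨f₁, hf₁, hf₁1, hff₁⟩ := exists_normalized_of_memLp (by linarith) hf
  obtain ⟨g₁, hg₁, hg₁1, hgg₁⟩ := exists_normalized_of_memLp (by linarith) hg
  have htf := hf.eLpNorm_ne_top
  have htg := hg.eLpNorm_ne_top
  set M := eLpNorm f (ENNReal.ofReal p) volume
  set N := eLpNorm g (ENNReal.ofReal q) (halfSpaceMeasure n)
  set K : Point n → Boundary n → ENNReal :=
    fun x ξ => ENNReal.ofReal (‖ξ‖ ^ (-α) * poissonKernel x ξ 2 * euclNorm x ^ α)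
  calc ∫⁻ x, ‖g x‖ₑ * ∫⁻ ξ, ‖f ξ‖ₑ * K x ξ ∂volume ∂(halfSpaceMeasure n)
      ≤ ∫⁻ x, N * M * (ENNReal.ofReal (g₁ x) * ∫⁻ ξ, ENNReal.ofReal (f₁ ξ) * K x ξ ∂volume)
          ∂(halfSpaceMeasure n) := by
        refine lintegral_mono_ae ?_
        filter_upwards [hgg₁] with x hx
        calc ‖g x‖ₑ * ∫⁻ ξ, ‖f ξ‖ₑ * K x ξ
            ≤ (N * ENNReal.ofReal (g₁ x)) * ∫⁻ ξ, M * (ENNReal.ofReal (f₁ ξ) * K x ξ) := by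
              refine mul_le_mul' hx (lintegral_mono_ae ?_)
              filter_upwards [hff₁] with ξ hξ
              rw [← mul_assoc]
              exact mul_le_mul' hξ le_rfl
          _ = _ := by
              rw [lintegral_const_mul' _ _ htf]
              ring
    _ = N * M * ∫⁻ x, ENNReal.ofReal (g₁ x) * ∫⁻ ξ, ENNReal.ofReal (f₁ ξ) * K x ξ ∂volume
          ∂(halfSpaceMeasure n) := lintegral_const_mul' _ _ (ENNReal.mul_ne_top htg htf)
    _ ≤ N * M * D := by
        gcongr
        exact hD' f₁ g₁ hf₁ hg₁ hf₁1 hg₁1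
    _ = _ := by ring

end SteinWeiss

/-! ### The Stein–Weiss inequality -/

theorem corollary1p4
    (n : ℕ) (hn : 3 ≤ n)
    (p p' q q' α β : ℝ)
    (hp : 1 < p) (hq' : 1 < q')
    (hpp' : 1 / p + 1 / p' = 1) (hqq' : 1 / q + 1 / q' = 1)
    (hα : α < ((n : ℝ) - 1) / p') (hβ : β < (n : ℝ) / q + 1) (hαβ : α + β = 0)
    (hscale : ((n : ℝ) - 1) / n * (1 / p) + 1 / q' = 1) :
    ∃ C : ℝ, 0 < C ∧
      ∀ (f : SteinWeiss.Boundary n → ℝ) (g : SteinWeiss.Point n → ℝ),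
        MemLp f (ENNReal.ofReal p) volume →
        MemLp g (ENNReal.ofReal q') (SteinWeiss.halfSpaceMeasure n) →
        Integrable
          (fun z : SteinWeiss.Point n × SteinWeiss.Boundary n =>
            ‖z.2‖ ^ (-α) * f z.2 * SteinWeiss.poissonKernel z.1 z.2 2 * g z.1 *
              SteinWeiss.euclNorm z.1 ^ (-β))
          ((SteinWeiss.halfSpaceMeasure n).prod volume) ∧
        ∫ x, ∫ ξ, ‖ξ‖ ^ (-α) * f ξ * SteinWeiss.poissonKernel x ξ 2 * g x *
              SteinWeiss.euclNorm x ^ (-β) ∂volume ∂(SteinWeiss.halfSpaceMeasure n)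
          ≤ C * (eLpNorm g (ENNReal.ofReal q') (SteinWeiss.halfSpaceMeasure n)).toReal *
              (eLpNorm f (ENNReal.ofReal p) volume).toReal := by
  have hn0 : (n : ℝ) ≠ 0 := by
    have : n ≠ 0 := by omega
    exact_mod_cast this
  have hβα : -β = α := by linarith
  have h1 : α < ((n : ℝ) - 1) * (1 - 1 / p) := by
    rw [div_eq_mul_one_div, show 1 / p' = 1 - 1 / p by linarith] at hα
    exact hα
  -- By the scaling relation `n / q = (n - 1) / p`.
  have h2 : -α < 1 + ((n : ℝ) - 1) * (1 / p) := by
    rw [div_eq_mul_one_div, show 1 / q = ((n : ℝ) - 1) / n * (1 / p) by linarith, ← mul_assoc,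
      mul_div_cancel₀ _ hn0] at hβ
    linarith
  obtain ⟨D, hD, hbound⟩ := SteinWeiss.exists_lintegral_weighted_poissonKernel_le
    (by omega : 2 ≤ n) hp hq' h1 h2 hscale
  rw [hβα]
  refine ⟨D.toReal + 1, by positivity, fun f g hf hg => ?_⟩
  set Φ : SteinWeiss.Point n × SteinWeiss.Boundary n → ℝ := fun z =>
    ‖z.2‖ ^ (-α) * f z.2 * SteinWeiss.poissonKernel z.1 z.2 2 * g z.1 *
      SteinWeiss.euclNorm z.1 ^ α with hΦ
  have hΦm : AEStronglyMeasurable Φ ((SteinWeiss.halfSpaceMeasure n).prod volume) := by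
    have := ((SteinWeiss.measurable_weighted_poissonKernel n α α).aestronglyMeasurable
      (μ := (SteinWeiss.halfSpaceMeasure n).prod volume)).mul (hf.1.comp_snd.mul hg.1.comp_fst)
    refine this.congr (Filter.Eventually.of_forall fun z => ?_)
    simp only [Pi.mul_apply, hΦ]
    ring
  -- Tonelli turns the bound on the iterated integral of absolute values into integrability on the
  -- product.
  have hle : ∫⁻ z, ‖Φ z‖ₑ ∂((SteinWeiss.halfSpaceMeasure n).prod volume) ≤
      D * eLpNorm g (ENNReal.ofReal q') (SteinWeiss.halfSpaceMeasure n) *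
        eLpNorm f (ENNReal.ofReal p) volume := by
    refine le_trans (le_of_eq ?_) (hbound f g hf hg)
    rw [lintegral_prod _ hΦm.enorm]
    refine lintegral_congr_ae ?_
    filter_upwards [SteinWeiss.ae_halfSpaceMeasure_snd_pos n] with x hx
    rw [← lintegral_const_mul' _ _ enorm_ne_top]
    refine lintegral_congr fun ξ => ?_
    have hnn : 0 ≤ ‖ξ‖ ^ (-α) * SteinWeiss.poissonKernel x ξ 2 * SteinWeiss.euclNorm x ^ α :=
      mul_nonneg (mul_nonneg (by positivity) (SteinWeiss.poissonKernel_nonneg hx ξ 2))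
        (Real.rpow_nonneg (SteinWeiss.euclNorm_pos hx).le _)
    rw [← Real.enorm_of_nonneg hnn, ← enorm_mul, ← enorm_mul]
    congr 1
    simp only [hΦ]
    ring
  have htop : D * eLpNorm g (ENNReal.ofReal q') (SteinWeiss.halfSpaceMeasure n) *
      eLpNorm f (ENNReal.ofReal p) volume ≠ ⊤ :=
    ENNReal.mul_ne_top (ENNReal.mul_ne_top hD hg.eLpNorm_ne_top) hf.eLpNorm_ne_top
  have hint : Integrable Φ ((SteinWeiss.halfSpaceMeasure n).prod volume) :=
    ⟨hΦm, hle.trans_lt htop.lt_top⟩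
  refine ⟨hint, ?_⟩
  calc ∫ x, ∫ ξ, Φ (x, ξ) ∂volume ∂(SteinWeiss.halfSpaceMeasure n)
      = ∫ z, Φ z ∂((SteinWeiss.halfSpaceMeasure n).prod volume) := (integral_prod _ hint).symm
    _ ≤ ∫ z, ‖Φ z‖ ∂((SteinWeiss.halfSpaceMeasure n).prod volume) :=
        (Real.le_norm_self _).trans (norm_integral_le_integral_norm _)
    _ = (∫⁻ z, ‖Φ z‖ₑ ∂((SteinWeiss.halfSpaceMeasure n).prod volume)).toReal :=
        integral_norm_eq_lintegral_enorm hΦm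
    _ ≤ (D * eLpNorm g (ENNReal.ofReal q') (SteinWeiss.halfSpaceMeasure n) *
          eLpNorm f (ENNReal.ofReal p) volume).toReal := ENNReal.toReal_mono htop hle
    _ ≤ _ := by
        rw [ENNReal.toReal_mul, ENNReal.toReal_mul]
        gcongr
        linarith
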